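/- Fix finite sets $\mathcal X,\mathcal Y$. A \emph{private coin protocol} is a finite rooted tree in which every non-leaf node is owned by Alice or by Bob, non-leaf children of a node belong to the other player, the children of each node are labelled by binary strings (messages) forming a prefix-free code, each non-leaf node carries a map from the inputs of its owner ($x\in\mathcal X$ for Alice, $y\in\mathcal Y$ for Bob) to probability distributions on its children, and each leaf is labelled by an output in $\{0,1\}$. On input $(x,y)$ one starts at the root; the owner of the current node samples a child from the distribution given by the owner's input, sends its label, and the protocol moves to that child, until a leaf is reached, whose label is the output $\pi(x,y)$. A \emph{public coin protocol} $\pi$ is a (discrete) probability distribution on private coin protocols: the shared randomness selects a private coin protocol $r$, which is then run. Its transcript $\Pi$ consists of $r$ and the concatenation of all messages sent. For a probability distribution $\mu$ on $\mathcal X\times\mathcal Y$ and $(X,Y)\sim\mu$, the (internal) information cost of $\pi$ is $$\mathsf{IC}_\mu(\pi)=I(X;\Pi\mid Y)+I(Y;\Pi\mid X),$$ where $I(A;B\mid C)=H(A\mid C)-H(A\mid B,C)$ and $H$ is Shannon (conditional) entropy in bits. For $f:\mathcal X\times\mathcal Y\to\{0,1\}$ and $\rho\ge 0$ the information complexity of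 $f$ is $$\mathsf{IC}_\mu(f,\rho)=\inf\{\mathsf{IC}_\mu(\pi)\;:\;\pi\text{ a public coin protocol with }\Pr[\pi(X,Y)\ne f(X,Y)]\le\rho\},$$ the probability being over $(X,Y)\sim\mu$ and all the coins. \textbf{Corollary.} Let $\mu_n$ be the uniform distribution on $\{0,1\}^n\times\{0,1\}^n$. (1) Let $IP_n(x,y)=\sum_{i=1}^n x_iy_i \bmod 2$. There are $c>0$ and $N\in\mathbb N$ such that $\mathsf{IC}_{\mu_n}(IP_n,1/10)\ge c\,n$ for all $n\ge N$. (2) There are $c,d>0$ and $N\in\mathbb N$ such that for all $n\ge N$, if $f_r:\{0,1\}^n\times\{0,1\}^n\to\{0,1\}$ is a uniformly random function, then $$\Pr_{f_r}\big[\mathsf{IC}_{\mu_n}(f_r,1/10)<c\,n\big]\le 2^{-d\,n}.$$ -/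

import Mathlib

noncomputable section

namespace InfoComplexity

/-! ### Discrete information theory (all logarithms are to base 2) -/

/-- Shannon entropy `∑ₐ w(a) log (1 / w(a))` of a probability mass function `w`. -/
def entropy {α : Type*} (w : α → ℝ) : ℝ :=
  ∑' a, w a * Real.logb 2 (1 / w a)

/-- Conditional entropy `H(A | B) = E_{b ∼ B} H(A | B = b)`, where `q` is the law of `(A, B)`. -/
def condEntropy {α β : Type*} (q : PMF (α × β)) : ℝ :=
  ∑' b, (q.map Prod.snd b).toReal *
    entropy (fun a => (q (a, b)).toReal / (q.map Prod.snd b).toReal)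

/-- Conditional mutual information `I(A; B | C) = H(A | C) - H(A | B, C)`, where `q` is the law of
`(A, B, C)`. It is used below only for `A` with values in a finite set, so that both conditional
entropies are finite. -/
def condMutualInfo {α β γ : Type*} (q : PMF (α × β × γ)) : ℝ :=
  condEntropy (q.map fun t => (t.1, t.2.2)) - condEntropy q

/-! ### Two-party communication protocols -/

/-- The two players. -/
inductive Player
  | alice
  | bob

/-- The opponent of a player. -/
def Player.other : Player → Player
  | .alice => .bob
  | .bob => .alice

/-- The set of possible inputs of a player. -/
def Player.Input (X Y : Type) : Player → Type
  | .alice => X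
  | .bob => Y

/-- The part of the input pair `(x, y)` that a player sees. -/
def Player.see {X Y : Type} : (p : Player) → X → Y → p.Input X Y
  | .alice, x, _ => x
  | .bob, _, y => y

/-- A finite protocol tree whose root, unless it is a leaf, is owned by the player `p`. A non-leaf
node has `m` children, which belong to the other player and carry binary labels (the messages)
forming a prefix-free code. The owner picks the next child at random, from a distribution that
depends on the owner's input only. Leaves are labelled by the output of the protocol. -/
inductive ProtocolTree (X Y : Type) : Player → Type
  | leaf {p : Player} (out : Bool) : ProtocolTree X Y p
  | node {p : Player} (m : ℕ) (label : Fin m → List Bool)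
      (prefixFree : ∀ i j, i ≠ j → ¬ label i <+: label j)
      (law : p.Input X Y → PMF (Fin m))
      (child : Fin m → ProtocolTree X Y p.other) : ProtocolTree X Y p

/-- The joint law of (concatenation of all messages, output) when the protocol tree is executed on
the input pair `(x, y)`, with independent private randomness at all nodes. -/
def ProtocolTree.run {X Y : Type} : {p : Player} → ProtocolTree X Y p → X → Y →
    PMF (List Bool × Bool)
  | _, .leaf out, _, _ => PMF.pure ([], out)
  | p, .node _ label _ law child, x, y =>
      (law (p.see x y)).bind fun i =>
        ((child i).run x y).map fun t => (label i ++ t.1, t.2)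

/-- A private coin protocol: a protocol tree together with the player who owns its root. -/
abbrev PrivateProtocol (X Y : Type) : Type :=
  (p : Player) × ProtocolTree X Y p

/-- A public coin protocol: a probability distribution on private coin protocols. -/
abbrev Protocol (X Y : Type) : Type :=
  PMF (PrivateProtocol X Y)

/-- Transcripts of a public coin protocol: the outcome of the public randomness, that is, the
private coin protocol which it selects, followed by all messages. -/
abbrev Transcript (X Y : Type) : Type :=
  PrivateProtocol X Y × List Bool

/-- The joint law of (transcript, output) of a public coin protocol on the input pair `(x, y)`. -/
def Protocol.run {X Y : Type} (π : Protocol X Y) (x : X) (y : Y) :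
    PMF (Transcript X Y × Bool) :=
  PMF.bind π fun r => (r.2.run x y).map fun t => ((r, t.1), t.2)

/-- The joint law of (inputs, transcript, output) when the inputs are drawn from `μ`. -/
def Protocol.joint {X Y : Type} (π : Protocol X Y) (μ : PMF (X × Y)) :
    PMF ((X × Y) × Transcript X Y × Bool) :=
  μ.bind fun z => (π.run z.1 z.2).map fun t => (z, t)

/-- The probability, over `(x, y) ∼ μ` and all random coins, that the output of the protocol
differs from `f (x, y)`. -/
def Protocol.error {X Y : Type} (π : Protocol X Y) (μ : PMF (X × Y)) (f : X × Y → Bool) : ℝ :=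
  ((π.joint μ).toOuterMeasure {ω | ω.2.2 ≠ f ω.1}).toReal

/-- The (internal) information cost `I(X; Π | Y) + I(Y; Π | X)` of a protocol, where `Π` is the
transcript and the inputs `(X, Y)` are drawn from `μ`. -/
def Protocol.infoCost {X Y : Type} (π : Protocol X Y) (μ : PMF (X × Y)) : ℝ :=
  condMutualInfo ((π.joint μ).map fun ω => (ω.1.1, ω.2.1, ω.1.2)) +
    condMutualInfo ((π.joint μ).map fun ω => (ω.1.2, ω.2.1, ω.1.1))

/-- The information complexity of `f` with respect to `μ` and error `ρ`: the infimum of the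
information costs of all protocols that compute `f` with error at most `ρ` with respect to `μ`. -/
def informationComplexity {X Y : Type} (f : X × Y → Bool) (μ : PMF (X × Y)) (ρ : ℝ) : ℝ :=
  sInf {I : ℝ | ∃ π : Protocol X Y, π.error μ f ≤ ρ ∧ π.infoCost μ = I}

/-! ### The functions and the distribution -/

/-- Bit strings of length `n`, i.e. `{0,1}ⁿ`. -/
abbrev Bits (n : ℕ) : Type := Fin n → Bool

/-- The uniform distribution on `{0,1}ⁿ × {0,1}ⁿ`. -/
def uniformInputs (n : ℕ) : PMF (Bits n × Bits n) :=
  PMF.uniformOfFintype (Bits n × Bits n)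

/-- The inner product function `∑ᵢ xᵢ yᵢ mod 2`. -/
def innerProduct (n : ℕ) : Bits n × Bits n → Bool :=
  fun z => decide ((∑ i, (z.1 i).toNat * (z.2 i).toNat) % 2 = 1)

/-- A uniformly random Boolean function on `{0,1}ⁿ × {0,1}ⁿ`. -/
def randomFunction (n : ℕ) : PMF (Bits n × Bits n → Bool) :=
  PMF.uniformOfFintype (Bits n × Bits n → Bool)

end InfoComplexity

end

namespace InfoComplexity

open Finset

/-! Given the inputs, the probability of a transcript τ factors as `a τ x * b τ y`, and τ fixes the
output. Under uniform inputs, X and Y are therefore independent given τ, with laws p and q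
proportional to `a τ` and `b τ`. With N = 2^n, the information cost is the expectation over τ of the
total entropy deficit 2 log N - H(p) - H(q).

Let F = (-1)^f. As the output is constant on τ, the expected absolute bias of F under p × q is at
least 1 - 2 · error. On the other hand, a small deficit leaves little mass on atoms heavier than
2^K/N (`mul_mass_le_deficit`), and on the remaining light parts two Cauchy–Schwarz steps bound the
bias by the box norm of F (`bilinear_pow_four_le`). Hence K · bias is at most the deficit plus 4 +
Kε, and averaging over τ gives `Protocol.le_infoCost`.

With K = n/16 this is linear in n as soon as `boxSum` F ≤ N^(7/2). Inner product has box sum N^3 by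
orthogonality of characters; a random function has expected box sum at most 2N^3, so Markov's
inequality applies. -/

/-! ### The rectangle property of transcripts -/

/-- Prefix-freeness lets at most one child account for a given message string. The probability of
moving to that child depends on the owner's input alone, so it is absorbed into `a` or into `b`. -/
theorem ProtocolTree.exists_rectangle {X Y : Type} {p : Player} (T : ProtocolTree X Y p)
    (t : List Bool) : ∃ (a : X → ENNReal) (b : Y → ENNReal) (out : Bool),
      ∀ x y o, T.run x y (t, o) = if o = out then a x * b y else 0 := by
  induction T generalizing t with
  | leaf out =>
    by_cases ht : t = []
    · refine ⟨fun _ => 1, fun _ => 1, out, fun x y o => ?_⟩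
      simp [ProtocolTree.run, PMF.pure_apply, ht]
    · refine ⟨fun _ => 0, fun _ => 0, out, fun x y o => ?_⟩
      simp [ProtocolTree.run, PMF.pure_apply, ht]
  | @node p m label prefixFree law child ih =>
    by_cases h : ∃ i s, label i ++ s = t
    · obtain ⟨i, s, rfl⟩ := h
      have key : ∀ x y o, (ProtocolTree.node m label prefixFree law child).run x y
          (label i ++ s, o) = law (p.see x y) i * (child i).run x y (s, o) := by
        intro x y o
        rw [ProtocolTree.run, PMF.bind_apply, tsum_eq_single i]
        · congr 1
          rw [PMF.map_apply, tsum_eq_single (s, o)]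
          · simp
          · rintro ⟨s', o'⟩ hne
            rw [if_neg]
            intro heq
            simp only [Prod.mk.injEq, List.append_cancel_left_eq] at heq
            exact hne (by rw [heq.1, heq.2])
        · intro j hj
          rw [PMF.map_apply, ENNReal.tsum_eq_zero.2, mul_zero]
          rintro ⟨s', o'⟩
          rw [if_neg]
          intro heq
          simp only [Prod.mk.injEq] at heq
          have h₁ : label i <+: label i ++ s := List.prefix_append _ _
          have h₂ : label j <+: label i ++ s := heq.1 ▸ List.prefix_append _ _
          rcases List.prefix_or_prefix_of_prefix h₁ h₂ with h | h
          · exact prefixFree i j hj.symm h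
          · exact prefixFree j i hj h
      obtain ⟨a, b, out, hab⟩ := ih i s
      cases p with
      | alice =>
        refine ⟨fun x => law x i * a x, b, out, fun x y o => ?_⟩
        rw [key, hab, mul_ite, mul_zero, mul_assoc]
        rfl
      | bob =>
        refine ⟨a, fun y => law y i * b y, out, fun x y o => ?_⟩
        rw [key, hab, mul_ite, mul_zero, mul_left_comm]
        rfl
    · refine ⟨fun _ => 0, fun _ => 0, false, fun x y o => ?_⟩
      push Not at h
      rw [ProtocolTree.run, PMF.bind_apply, ENNReal.tsum_eq_zero.2]
      · simp
      · intro i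
        rw [PMF.map_apply, ENNReal.tsum_eq_zero.2, mul_zero]
        rintro ⟨s, o'⟩
        rw [if_neg]
        intro heq
        simp only [Prod.mk.injEq] at heq
        exact h i s heq.1.symm

theorem Protocol.run_apply {X Y : Type} (π : Protocol X Y) (x : X) (y : Y)
    (r : PrivateProtocol X Y) (t : List Bool) (o : Bool) :
    π.run x y ((r, t), o) = π r * r.2.run x y (t, o) := by
  rw [Protocol.run, PMF.bind_apply, tsum_eq_single r]
  · congr 1
    rw [PMF.map_apply, tsum_eq_single (t, o)]
    · simp
    · rintro ⟨t', o'⟩ hne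
      rw [if_neg]
      intro heq
      simp only [Prod.mk.injEq, true_and] at heq
      exact hne (by rw [heq.1, heq.2])
  · intro r' hr
    rw [PMF.map_apply, ENNReal.tsum_eq_zero.2, mul_zero]
    rintro ⟨t', o'⟩
    rw [if_neg]
    intro heq
    simp only [Prod.mk.injEq] at heq
    exact hr heq.1.1.symm

/-- The transcript records the public coins r, so their probability is a constant factor, here given
to Alice's side. -/
theorem Protocol.exists_rectangle {X Y : Type} (π : Protocol X Y) :
    ∃ (a : Transcript X Y → X → ℝ) (b : Transcript X Y → Y → ℝ) (out : Transcript X Y → Bool),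
      (∀ τ x, 0 ≤ a τ x) ∧ (∀ τ y, 0 ≤ b τ y) ∧
      ∀ x y τ o, (π.run x y (τ, o)).toReal = if o = out τ then a τ x * b τ y else 0 := by
  have h : ∀ τ : Transcript X Y, ∃ (a : X → ENNReal) (b : Y → ENNReal) (out : Bool),
      ∀ x y o, π.run x y (τ, o) = if o = out then a x * b y else 0 := by
    rintro ⟨r, t⟩
    obtain ⟨a, b, out, hab⟩ := r.2.exists_rectangle t
    refine ⟨fun x => π r * a x, b, out, fun x y o => ?_⟩
    rw [π.run_apply, hab, mul_ite, mul_zero, mul_assoc]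
  choose a b out hab using h
  refine ⟨fun τ x => (a τ x).toReal, fun τ y => (b τ y).toReal, out,
    fun _ _ => ENNReal.toReal_nonneg, fun _ _ => ENNReal.toReal_nonneg, fun x y τ o => ?_⟩
  rw [hab]
  split_ifs <;> simp

theorem Protocol.joint_apply {X Y : Type} (π : Protocol X Y) (μ : PMF (X × Y)) (z : X × Y)
    (t : Transcript X Y × Bool) : π.joint μ (z, t) = μ z * π.run z.1 z.2 t := by
  rw [Protocol.joint, PMF.bind_apply, tsum_eq_single z]
  · congr 1
    rw [PMF.map_apply, tsum_eq_single t]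
    · simp
    · intro t' hne
      rw [if_neg]
      intro heq
      simp only [Prod.mk.injEq, true_and] at heq
      exact hne heq.symm
  · intro z' hz
    rw [PMF.map_apply, ENNReal.tsum_eq_zero.2, mul_zero]
    intro t'
    rw [if_neg]
    intro heq
    simp only [Prod.mk.injEq] at heq
    exact hz heq.1.symm

theorem map_apply_eq_tsum {α β γ : Type*} (q : PMF α) (f : α → β) (b : β) (g : γ → α)
    (hg : Function.Injective g) (hfib : ∀ a, f a = b ↔ ∃ c, g c = a) :
    q.map f b = ∑' c, q (g c) := by
  classical
  rw [PMF.map_apply, ← hg.tsum_eq]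
  · refine tsum_congr fun c => ?_
    rw [if_pos ((hfib _).2 ⟨c, rfl⟩).symm]
  · intro a ha
    refine (hfib a).1 ?_
    by_contra hne
    exact ha (if_neg fun h => hne h.symm)

theorem hasSum_toReal {α : Type*} (q : PMF α) : HasSum (fun a => (q a).toReal) 1 := by
  have h := ENNReal.hasSum_toReal (f := q) (by rw [q.tsum_coe]; simp)
  rwa [← ENNReal.tsum_toReal_eq (fun a => q.apply_ne_top a), q.tsum_coe, ENNReal.toReal_one] at h

/-! ### Entropy deficit and heavy atoms -/

theorem entropy_eq_sum {α : Type*} [Fintype α] (p : α → ℝ) :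
    entropy p = ∑ a, p a * Real.logb 2 (1 / p a) := tsum_fintype _

theorem entropy_nonneg {α : Type*} [Fintype α] {p : α → ℝ} (h0 : ∀ a, 0 ≤ p a)
    (h1 : ∀ a, p a ≤ 1) : 0 ≤ entropy p := by
  rw [entropy_eq_sum]
  refine sum_nonneg fun a _ => mul_nonneg (h0 a) ?_
  rcases (h0 a).eq_or_lt with h | h
  · simp [← h]
  · exact Real.logb_nonneg (by norm_num) ((one_le_div h).2 (h1 a))

/-- From ln(uN) ≥ 1 - 1/(uN) follows u ln(uN) ≥ -1/N; passing to base 2 costs a factor below 2,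
since ln 2 > 1/2. -/
theorem sub_le_mul_logb {u N : ℝ} (hu : 0 ≤ u) (hN : 0 < N) :
    -(2 / N) ≤ u * (Real.logb 2 N - Real.logb 2 (1 / u)) := by
  rcases hu.eq_or_lt with rfl | hu
  · simp; positivity
  have hl : (1 / 2 : ℝ) < Real.log 2 := by linarith [Real.log_two_gt_d9]
  have h1 : Real.log (1 / (u * N)) ≤ 1 / (u * N) - 1 := Real.log_le_sub_one_of_pos (by positivity)
  have h2 : Real.log (1 / (u * N)) = -(Real.log N - Real.log (1 / u)) := by
    rw [one_div, one_div, Real.log_inv, Real.log_inv, Real.log_mul hu.ne' hN.ne']; ring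
  have h3 : 1 - 1 / (u * N) ≤ Real.log N - Real.log (1 / u) := by linarith
  have h4 : u * (Real.logb 2 N - Real.logb 2 (1 / u))
      = u * (Real.log N - Real.log (1 / u)) / Real.log 2 := by
    simp only [Real.logb]; ring
  rw [h4, le_div_iff₀ (by linarith)]
  have h5 : u * (1 - 1 / (u * N)) = u - 1 / N := by field_simp
  have h6 := mul_le_mul_of_nonneg_left h3 hu.le
  rw [h5] at h6
  have h7 : 1 / N ≤ 2 / N * Real.log 2 := by
    rw [div_mul_eq_mul_div]
    exact div_le_div_of_nonneg_right (by linarith) hN.le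
  linarith

/-- The deficit is ∑ p log(Np). A heavy atom contributes at least K p, any other at least -2/N; over
N atoms the latter loss totals at most 2. -/
theorem mul_mass_le_deficit {α : Type*} [Fintype α] {p : α → ℝ} (h0 : ∀ a, 0 ≤ p a)
    (h1 : ∑ a, p a = 1) {N K : ℝ} (hN : 0 < N) (hc : (Fintype.card α : ℝ) = N) :
    K * ∑ a, (if 2 ^ K / N < p a then p a else 0) ≤ Real.logb 2 N - entropy p + 2 := by
  have e1 : Real.logb 2 N - entropy p
      = ∑ a, p a * (Real.logb 2 N - Real.logb 2 (1 / p a)) := by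
    simp only [mul_sub, sum_sub_distrib, ← sum_mul, h1, one_mul, entropy_eq_sum]
  have e2 : (2 : ℝ) = ∑ _a : α, 2 / N := by
    rw [sum_const, nsmul_eq_mul, card_univ, hc]; field_simp
  have e3 : Real.logb 2 N - entropy p + 2
      = ∑ a, (p a * (Real.logb 2 N - Real.logb 2 (1 / p a)) + 2 / N) := by
    rw [sum_add_distrib, ← e1, ← e2]
  rw [e3, mul_sum]
  refine sum_le_sum fun a _ => ?_
  have hp : 0 < 2 / N := by positivity
  split_ifs with h
  · have hpos : 0 < p a := lt_of_le_of_lt (by positivity) h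
    have : K ≤ Real.logb 2 N - Real.logb 2 (1 / p a) := by
      rw [one_div, Real.logb_inv, sub_neg_eq_add, ← Real.logb_mul hN.ne' hpos.ne',
        Real.le_logb_iff_rpow_le (by norm_num) (by positivity)]
      rw [div_lt_iff₀ hN] at h
      linarith
    nlinarith
  · linarith [sub_le_mul_logb (h0 a) hN]

theorem entropy_le {α : Type*} [Fintype α] {p : α → ℝ} (h0 : ∀ a, 0 ≤ p a)
    (h1 : ∑ a, p a = 1) {N : ℝ} (hN : 0 < N) (hc : (Fintype.card α : ℝ) = N) :
    entropy p ≤ Real.logb 2 N + 2 := by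
  -- The slack 2 is harmless: this bound only serves summability.
  have := mul_mass_le_deficit (K := 0) h0 h1 hN hc
  linarith

/-! ### The box norm and bias under product distributions -/

/-- The fourth power of the box norm of the matrix `F`. -/
noncomputable def boxSum {α β : Type*} [Fintype α] [Fintype β] (F : α → β → ℝ) : ℝ :=
  ∑ y, ∑ y', (∑ x, F x y * F x y') ^ 2

/-- Cauchy–Schwarz over x eliminates p; expanding the square and applying it again over pairs (y,
y') eliminates q. -/
theorem bilinear_pow_four_le {α β : Type*} [Fintype α] [Fintype β] (F : α → β → ℝ)
    (p : α → ℝ) (q : β → ℝ) :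
    (∑ x, ∑ y, p x * q y * F x y) ^ 4
      ≤ (∑ x, p x ^ 2) ^ 2 * (∑ y, q y ^ 2) ^ 2 * boxSum F := by
  have h1 : (∑ x, ∑ y, p x * q y * F x y) ^ 2
      ≤ (∑ x, p x ^ 2) * ∑ x, (∑ y, q y * F x y) ^ 2 := by
    have : ∑ x, ∑ y, p x * q y * F x y = ∑ x, p x * ∑ y, q y * F x y := by
      simp only [mul_sum, mul_assoc]
    rw [this]
    exact sum_mul_sq_le_sq_mul_sq _ _ _
  have h2 : ∑ x, (∑ y, q y * F x y) ^ 2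
      = ∑ z : β × β, (q z.1 * q z.2) * ∑ x, F x z.1 * F x z.2 := by
    simp only [sq (∑ y, _), sum_mul_sum, ← Fintype.sum_prod_type']
    rw [Fintype.sum_prod_type_right]
    refine sum_congr rfl fun z _ => ?_
    rw [mul_sum]
    exact sum_congr rfl fun x _ => by ring
  have h3 : (∑ x, (∑ y, q y * F x y) ^ 2) ^ 2 ≤ (∑ y, q y ^ 2) ^ 2 * boxSum F := by
    rw [h2]
    refine (sum_mul_sq_le_sq_mul_sq _ _ _).trans (le_of_eq ?_)
    congr 1
    · rw [sq (∑ y, q y ^ 2), sum_mul_sum, Fintype.sum_prod_type]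
      simp only [mul_pow]
    · rw [Fintype.sum_prod_type, boxSum]
  have h4 : 0 ≤ (∑ x, ∑ y, p x * q y * F x y) ^ 2 := sq_nonneg _
  calc (∑ x, ∑ y, p x * q y * F x y) ^ 4
      = ((∑ x, ∑ y, p x * q y * F x y) ^ 2) ^ 2 := by ring
    _ ≤ ((∑ x, p x ^ 2) * ∑ x, (∑ y, q y * F x y) ^ 2) ^ 2 := pow_le_pow_left₀ h4 h1 2
    _ = (∑ x, p x ^ 2) ^ 2 * (∑ x, (∑ y, q y * F x y) ^ 2) ^ 2 := by ring
    _ ≤ (∑ x, p x ^ 2) ^ 2 * ((∑ y, q y ^ 2) ^ 2 * boxSum F) :=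
        mul_le_mul_of_nonneg_left h3 (sq_nonneg _)
    _ = _ := by ring

theorem boxSum_nonneg {α β : Type*} [Fintype α] [Fintype β] (F : α → β → ℝ) : 0 ≤ boxSum F :=
  sum_nonneg fun _ _ => sum_nonneg fun _ _ => sq_nonneg _

theorem sum_sq_light_le {α : Type*} [Fintype α] {p : α → ℝ} (h0 : ∀ a, 0 ≤ p a)
    (h1 : ∑ a, p a = 1) {M : ℝ} (hM : 0 ≤ M) :
    ∑ a, (if M < p a then 0 else p a) ^ 2 ≤ M := by
  calc ∑ a, (if M < p a then 0 else p a) ^ 2 ≤ ∑ a, M * p a := by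
        refine sum_le_sum fun a _ => ?_
        split_ifs with h
        · have := mul_nonneg hM (h0 a)
          simpa using this
        · rw [sq]
          exact mul_le_mul_of_nonneg_right (not_lt.1 h) (h0 a)
    _ = M := by rw [← mul_sum, h1, mul_one]

theorem abs_bilinear_le {α β : Type*} [Fintype α] [Fintype β] {F : α → β → ℝ}
    (hF : ∀ x y, |F x y| ≤ 1) (p : α → ℝ) (q : β → ℝ) :
    |∑ x, ∑ y, p x * q y * F x y| ≤ (∑ x, |p x|) * ∑ y, |q y| := by
  rw [sum_mul_sum]
  refine (abs_sum_le_sum_abs _ _).trans (sum_le_sum fun x _ => ?_)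
  refine (abs_sum_le_sum_abs _ _).trans (sum_le_sum fun y _ => ?_)
  rw [abs_mul, abs_mul]
  exact mul_le_of_le_one_right (by positivity) (hF x y)

/-- Split p and q at height M. Any product with a heavy factor is bounded by that factor's mass; the
light-light term has squared 2-norms at most M, so the box norm controls it. -/
theorem abs_bias_le {α β : Type*} [Fintype α] [Fintype β] {F : α → β → ℝ}
    (hF : ∀ x y, |F x y| ≤ 1) {p : α → ℝ} {q : β → ℝ} (hp0 : ∀ a, 0 ≤ p a)
    (hp1 : ∑ a, p a = 1) (hq0 : ∀ a, 0 ≤ q a) (hq1 : ∑ a, q a = 1) {M ε : ℝ} (hM : 0 ≤ M)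
    (hε : 0 ≤ ε) (hbox : M ^ 4 * boxSum F ≤ ε ^ 4) :
    |∑ x, ∑ y, p x * q y * F x y| ≤ ∑ x, (if M < p x then p x else 0)
      + ∑ y, (if M < q y then q y else 0) + ε := by
  set p₁ : α → ℝ := fun x => if M < p x then p x else 0 with hp₁
  set p₂ : α → ℝ := fun x => if M < p x then 0 else p x with hp₂
  set q₁ : β → ℝ := fun x => if M < q x then q x else 0 with hq₁
  set q₂ : β → ℝ := fun x => if M < q x then 0 else q x with hq₂
  have hp₁0 : ∀ x, 0 ≤ p₁ x := fun x => by simp only [hp₁]; split_ifs <;> simp [hp0]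
  have hq₁0 : ∀ x, 0 ≤ q₁ x := fun x => by simp only [hq₁]; split_ifs <;> simp [hq0]
  have hp₂0 : ∀ x, 0 ≤ p₂ x := fun x => by simp only [hp₂]; split_ifs <;> simp [hp0]
  have hp₂le : ∀ x, p₂ x ≤ p x := fun x => by simp only [hp₂]; split_ifs <;> simp [hp0]
  have hp : ∀ x, p x = p₁ x + p₂ x := fun x => by simp only [hp₁, hp₂]; split_ifs <;> simp
  have hq : ∀ x, q x = q₁ x + q₂ x := fun x => by simp only [hq₁, hq₂]; split_ifs <;> simp
  have hsplit : ∑ x, ∑ y, p x * q y * F x y = ∑ x, ∑ y, p₁ x * q y * F x y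
      + ∑ x, ∑ y, p₂ x * q₁ y * F x y + ∑ x, ∑ y, p₂ x * q₂ y * F x y := by
    simp only [← sum_add_distrib]
    refine sum_congr rfl fun x _ => sum_congr rfl fun y _ => ?_
    rw [hp x, hq y]; ring
  have b1 : |∑ x, ∑ y, p₁ x * q y * F x y| ≤ ∑ x, p₁ x := by
    refine (abs_bilinear_le hF _ _).trans ?_
    simp only [abs_of_nonneg (hp₁0 _), abs_of_nonneg (hq0 _), hq1, mul_one, le_refl]
  have b2 : |∑ x, ∑ y, p₂ x * q₁ y * F x y| ≤ ∑ y, q₁ y := by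
    refine (abs_bilinear_le hF _ _).trans ?_
    simp only [abs_of_nonneg (hp₂0 _), abs_of_nonneg (hq₁0 _)]
    refine mul_le_of_le_one_left (sum_nonneg fun y _ => hq₁0 y) ?_
    rw [← hp1]
    exact sum_le_sum fun x _ => hp₂le x
  have b3 : |∑ x, ∑ y, p₂ x * q₂ y * F x y| ≤ ε := by
    refine (pow_le_pow_iff_left₀ (abs_nonneg _) hε four_ne_zero).1 ?_
    rw [← abs_pow, abs_of_nonneg (by positivity)]
    refine (bilinear_pow_four_le F p₂ q₂).trans (le_trans ?_ hbox)
    refine mul_le_mul_of_nonneg_right ?_ (boxSum_nonneg F)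
    have u1 := pow_le_pow_left₀ (sum_nonneg fun x _ => sq_nonneg _) (sum_sq_light_le hp0 hp1 hM) 2
    have u2 := pow_le_pow_left₀ (sum_nonneg fun x _ => sq_nonneg _) (sum_sq_light_le hq0 hq1 hM) 2
    calc _ ≤ M ^ 2 * M ^ 2 := mul_le_mul u1 u2 (sq_nonneg _) (sq_nonneg _)
      _ = M ^ 4 := by ring
  rw [hsplit]
  refine (abs_add_le _ _).trans (add_le_add ((abs_add_le _ _).trans (add_le_add b1 b2)) b3)

/-- If the entropies of `p` and `q` are large, then the bias of `F` under `p × q` is small. -/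
theorem entropy_add_entropy_le {α β : Type*} [Fintype α] [Fintype β] {F : α → β → ℝ}
    (hF : ∀ x y, |F x y| ≤ 1) {p : α → ℝ} {q : β → ℝ} (hp0 : ∀ a, 0 ≤ p a)
    (hp1 : ∑ a, p a = 1) (hq0 : ∀ a, 0 ≤ q a) (hq1 : ∑ a, q a = 1) {N K ε : ℝ} (hN : 0 < N)
    (hα : (Fintype.card α : ℝ) = N) (hβ : (Fintype.card β : ℝ) = N) (hK : 0 ≤ K)
    (hε : 0 ≤ ε) (hbox : (2 ^ K / N) ^ 4 * boxSum F ≤ ε ^ 4) :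
    entropy p + entropy q ≤ 2 * Real.logb 2 N + 4 + K * ε
      - K * |∑ x, ∑ y, p x * q y * F x y| := by
  have h1 := mul_mass_le_deficit (K := K) hp0 hp1 hN hα
  have h2 := mul_mass_le_deficit (K := K) hq0 hq1 hN hβ
  have h3 := abs_bias_le hF hp0 hp1 hq0 hq1 (by positivity) hε hbox
  have h4 := mul_le_mul_of_nonneg_left h3 hK
  rw [mul_add, mul_add] at h4
  linarith

/-! ### Conditional entropy given a transcript -/

/-- By the product form, the law of x given (τ, y) does not depend on y, so the sum over y only
collects weights. -/
theorem condEntropy_hasSum {α β T : Type*} [Fintype α] [Fintype β] (q : PMF (α × T × β))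
    (c : ℝ) (hc : 0 ≤ c) (a : T → α → ℝ) (b : T → β → ℝ) (ha : ∀ τ x, 0 ≤ a τ x)
    (hb : ∀ τ y, 0 ≤ b τ y) (hq : ∀ x τ y, (q (x, τ, y)).toReal = c * (a τ x * b τ y)) :
    HasSum (fun τ => c * ((∑ x, a τ x) * ∑ y, b τ y) * entropy fun x => a τ x / ∑ x, a τ x)
      (condEntropy q) := by
  have hmap : ∀ τ y, (q.map Prod.snd (τ, y)).toReal = c * ((∑ x, a τ x) * b τ y) := by
    intro τ y
    rw [map_apply_eq_tsum q Prod.snd (τ, y) (fun x => (x, (τ, y)))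
      (fun x x' h => (Prod.mk.inj h).1), tsum_fintype,
      ENNReal.toReal_sum fun x _ => q.apply_ne_top _]
    · simp only [hq, sum_mul, mul_sum]
    · rintro ⟨x, t⟩
      constructor
      · rintro rfl
        exact ⟨x, rfl⟩
      · rintro ⟨x', h⟩
        exact (Prod.mk.inj h).2.symm
  have hterm : ∀ t : T × β, (q.map Prod.snd t).toReal *
      entropy (fun x => (q (x, t)).toReal / (q.map Prod.snd t).toReal)
      = c * ((∑ x, a t.1 x) * b t.1 t.2) * entropy fun x => a t.1 x / ∑ x, a t.1 x := by
    rintro ⟨τ, y⟩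
    simp only [hmap, hq]
    by_cases h : c * b τ y = 0
    · have : c * ((∑ x, a τ x) * b τ y) = 0 := by rw [mul_left_comm, h, mul_zero]
      rw [this, zero_mul, zero_mul]
    · congr 2
      funext x
      rw [mul_left_comm, mul_left_comm c (∑ x, a τ x), mul_div_mul_right _ _ h]
  have hA : ∀ τ, 0 ≤ ∑ x, a τ x := fun τ => sum_nonneg fun x _ => ha τ x
  have hsummable : Summable fun t : T × β => (q.map Prod.snd t).toReal *
      entropy (fun x => (q (x, t)).toReal / (q.map Prod.snd t).toReal) := by
    refine Summable.of_nonneg_of_le (fun t => ?_) (fun t => ?_)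
      ((hasSum_toReal (q.map Prod.snd)).summable.mul_right
        (Real.logb 2 (Fintype.card α : ℝ) + 2))
    · rw [hterm]
      refine mul_nonneg (mul_nonneg hc (mul_nonneg (hA _) (hb _ _)))
        (entropy_nonneg (fun x => div_nonneg (ha _ _) (hA _)) fun x => ?_)
      exact div_le_one_of_le₀ (single_le_sum (f := a t.1) (fun x _ => ha _ x) (mem_univ x)) (hA _)
    · rw [hterm, hmap]
      rcases (hA t.1).eq_or_lt with h | h
      · rw [← h]; simp
      · refine mul_le_mul_of_nonneg_left ?_ (mul_nonneg hc (mul_nonneg (hA _) (hb _ _)))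
        have hne : Nonempty α := by
          by_contra hn
          rw [not_nonempty_iff] at hn
          simp at h
        refine entropy_le (fun x => div_nonneg (ha _ _) (hA _)) ?_
          (by exact_mod_cast Fintype.card_pos) rfl
        rw [← sum_div, div_self h.ne']
  have h := hsummable.hasSum.prod_fiberwise fun τ => hasSum_fintype _
  refine (congrArg (HasSum · _) (funext fun τ => ?_)).mp h
  simp only [hterm, ← sum_mul, ← mul_sum]

theorem condEntropy_uniform {α β : Type*} [Fintype α] [Fintype β] [Nonempty α] [Nonempty β]
    (q : PMF (α × β)) (hq : q = PMF.uniformOfFintype (α × β)) :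
    condEntropy q = Real.logb 2 (Fintype.card α) := by
  have hα : (Fintype.card α : ℝ) ≠ 0 := by simp
  have hβ : (Fintype.card β : ℝ) ≠ 0 := by simp
  have hv : ∀ x y, (q (x, y)).toReal = (Fintype.card α : ℝ)⁻¹ * (Fintype.card β : ℝ)⁻¹ := by
    intro x y
    rw [hq, PMF.uniformOfFintype_apply]
    simp [mul_comm]
  have hmap : ∀ y, (q.map Prod.snd y).toReal = (Fintype.card β : ℝ)⁻¹ := by
    intro y
    rw [map_apply_eq_tsum q Prod.snd y (fun x => (x, y))
      (fun x x' h => (Prod.mk.inj h).1), tsum_fintype,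
      ENNReal.toReal_sum fun x _ => q.apply_ne_top _]
    · simp only [hv, sum_const, card_univ, nsmul_eq_mul]
      field_simp
    · rintro ⟨x, t⟩
      constructor
      · rintro rfl
        exact ⟨x, rfl⟩
      · rintro ⟨x', h⟩
        exact (Prod.mk.inj h).2.symm
  rw [condEntropy, tsum_fintype]
  simp only [hmap, hv, entropy_eq_sum, sum_const, card_univ, nsmul_eq_mul]
  field_simp

theorem Protocol.map_joint_fst {X Y : Type} (π : Protocol X Y) (μ : PMF (X × Y)) :
    (π.joint μ).map Prod.fst = μ := by
  rw [Protocol.joint, PMF.map_bind]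
  simp only [PMF.map_comp]
  have : ∀ z : X × Y, PMF.map (Prod.fst ∘ fun t => (z, t)) (π.run z.1 z.2) = PMF.pure z :=
    fun z => PMF.map_const _ z
  simp only [this, PMF.bind_pure]

/-! ### Output bias and the general lower bound on information cost -/

/-- The sign `(-1)^b`. -/
def sign (b : Bool) : ℝ := if b then -1 else 1

theorem sign_mul_sign (b b' : Bool) : sign b * sign b' = 1 - 2 * if b' ≠ b then 1 else 0 := by
  cases b <;> cases b' <;> norm_num [sign]

theorem abs_sign (b : Bool) : |sign b| = 1 := by
  cases b <;> norm_num [sign]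

theorem map_swap_uniform {α β : Type*} [Fintype α] [Fintype β] [Nonempty α] [Nonempty β] :
    (PMF.uniformOfFintype (α × β)).map Prod.swap = PMF.uniformOfFintype (β × α) := by
  ext ⟨y, x⟩
  rw [map_apply_eq_tsum _ Prod.swap (y, x) (fun _ : Unit => (x, y))
    (fun _ _ _ => Subsingleton.elim _ _)]
  · simp [mul_comm]
  · rintro ⟨x', y'⟩
    simp [and_comm, eq_comm]

theorem Protocol.hasSum_error {X Y : Type} (π : Protocol X Y) (μ : PMF (X × Y))
    (f : X × Y → Bool) :
    HasSum (fun ω => (π.joint μ ω).toReal * (sign (f ω.1) * sign ω.2.2))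
      (1 - 2 * π.error μ f) := by
  classical
  have h1 := hasSum_toReal (π.joint μ)
  have h2 : HasSum (fun ω => ({ω | ω.2.2 ≠ f ω.1}.indicator (π.joint μ) ω).toReal)
      (π.error μ f) := by
    have hne : ∑' ω, {ω | ω.2.2 ≠ f ω.1}.indicator (π.joint μ) ω ≠ ⊤ := by
      refine ne_top_of_le_ne_top ENNReal.one_ne_top ?_
      rw [← (π.joint μ).tsum_coe]
      exact ENNReal.tsum_le_tsum fun ω => Set.indicator_le_self _ _ ω
    have := ENNReal.hasSum_toReal hne
    rwa [← ENNReal.tsum_toReal_eq fun ω => ENNReal.ne_top_of_tsum_ne_top hne ω,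
      ← PMF.toOuterMeasure_apply] at this
  refine (congrArg (HasSum · _) (funext fun ω => ?_)).mp (h1.sub (h2.mul_left 2))
  symm
  rw [sign_mul_sign, Set.indicator_apply]
  by_cases h : ω.2.2 ≠ f ω.1
  · simp only [Set.mem_ofPred_eq, if_pos h]; ring
  · simp only [Set.mem_ofPred_eq, if_neg h]; simp

/-- The entropy-bias inequality `entropy_add_entropy_le` is applied to each transcript's posteriors
and averaged with the transcript's probability. -/
theorem Protocol.le_infoCost {X Y : Type} [Fintype X] [Fintype Y] [Nonempty X] [Nonempty Y]
    (π : Protocol X Y) (f : X × Y → Bool) {N K ε : ℝ} (hX : (Fintype.card X : ℝ) = N)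
    (hY : (Fintype.card Y : ℝ) = N) (hK : 0 ≤ K) (hε : 0 ≤ ε)
    (hbox : (2 ^ K / N) ^ 4 * boxSum (fun x y => sign (f (x, y))) ≤ ε ^ 4) :
    K * (1 - 2 * π.error (PMF.uniformOfFintype (X × Y)) f - ε) - 4
      ≤ π.infoCost (PMF.uniformOfFintype (X × Y)) := by
  obtain ⟨a, b, out, ha, hb, hrun⟩ := π.exists_rectangle
  set μ := PMF.uniformOfFintype (X × Y) with hμ
  have hN : 0 < N := hX ▸ by exact_mod_cast Fintype.card_pos
  set c : ℝ := (N * N)⁻¹ with hcdef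
  have hc : 0 ≤ c := by positivity
  have hJ : ∀ x y τ o, (π.joint μ ((x, y), (τ, o))).toReal
      = if o = out τ then c * (a τ x * b τ y) else 0 := by
    intro x y τ o
    rw [π.joint_apply, ENNReal.toReal_mul, hrun, mul_ite, mul_zero]
    congr 2
    simp [hμ, hcdef, ← hX, hX.trans hY.symm]
  -- sums over `ω` reduce to sums over transcripts
  have htrans : ∀ (G : (X × Y) × Transcript X Y × Bool → ℝ) (v : ℝ),
      HasSum (fun ω => (π.joint μ ω).toReal * G ω) v →
      HasSum (fun τ => ∑ z : X × Y, c * (a τ z.1 * b τ z.2) * G (z, τ, out τ)) v := by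
    intro G v h
    -- The joint law vanishes off the range of `g`, because τ determines the output.
    let g : Transcript X Y × (X × Y) → (X × Y) × Transcript X Y × Bool :=
      fun t => (t.2, t.1, out t.1)
    have hg : Function.Injective g := by
      rintro ⟨τ, z⟩ ⟨τ', z'⟩ h
      simp only [g, Prod.mk.injEq] at h
      rw [h.1, h.2.1]
    rw [← hg.hasSum_iff] at h
    · have := h.prod_fiberwise fun τ => hasSum_fintype _
      convert this using 1
      funext τ
      refine sum_congr rfl fun z _ => ?_
      obtain ⟨x, y⟩ := z
      simp [g, hJ]
    · rintro ⟨⟨x, y⟩, τ, o⟩ hω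
      rw [hJ, if_neg, zero_mul]
      rintro rfl
      exact hω ⟨(τ, (x, y)), rfl⟩
  have hone := htrans (fun _ => 1) 1 (by simpa using hasSum_toReal (π.joint μ))
  have herr := htrans _ _ (π.hasSum_error μ f)
  have hinj : ∀ (x : X) (y : Y) (τ : Transcript X Y),
      Function.Injective fun o : Bool => ((x, y), (τ, o)) :=
    fun x y τ o o' h => by simpa using h
  have hX' : condMutualInfo ((π.joint μ).map fun ω => (ω.1.1, ω.2.1, ω.1.2))
      = Real.logb 2 N - condEntropy ((π.joint μ).map fun ω => (ω.1.1, ω.2.1, ω.1.2)) := by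
    rw [condMutualInfo, condEntropy_uniform, hX]
    rw [PMF.map_comp, ← hμ]
    exact π.map_joint_fst μ
  have hY' : condMutualInfo ((π.joint μ).map fun ω => (ω.1.2, ω.2.1, ω.1.1))
      = Real.logb 2 N - condEntropy ((π.joint μ).map fun ω => (ω.1.2, ω.2.1, ω.1.1)) := by
    rw [condMutualInfo, condEntropy_uniform, hY]
    rw [PMF.map_comp, ← map_swap_uniform, ← hμ]
    conv_rhs => rw [← π.map_joint_fst μ, PMF.map_comp]
    rfl
  have hsX := condEntropy_hasSum ((π.joint μ).map fun ω => (ω.1.1, ω.2.1, ω.1.2)) c hc a b ha hb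
    (by
      intro x τ y
      rw [map_apply_eq_tsum _ _ _ _ (hinj x y τ), tsum_bool,
        ENNReal.toReal_add (PMF.apply_ne_top _ _) (PMF.apply_ne_top _ _), hJ, hJ]
      · cases out τ <;> simp
      · rintro ⟨⟨x', y'⟩, τ', o⟩
        simp [Prod.ext_iff, eq_comm]; tauto)
  have hsY := condEntropy_hasSum ((π.joint μ).map fun ω => (ω.1.2, ω.2.1, ω.1.1)) c hc b a hb ha
    (by
      intro y τ x
      rw [map_apply_eq_tsum _ _ _ _ (hinj x y τ), tsum_bool,
        ENNReal.toReal_add (PMF.apply_ne_top _ _) (PMF.apply_ne_top _ _), hJ, hJ]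
      · cases out τ <;> simp [mul_comm]
      · rintro ⟨⟨x', y'⟩, τ', o⟩
        simp [Prod.ext_iff, eq_comm]; tauto)
  have hle := hasSum_le (fun τ => ?_) (hsX.add hsY)
    ((hone.mul_right (2 * Real.logb 2 N + 4 + K * ε)).sub (herr.mul_left K))
  · rw [Protocol.infoCost, hX', hY']
    linarith
  · set A := ∑ x, a τ x with hA
    set B := ∑ y, b τ y with hB
    have hA0 : 0 ≤ A := sum_nonneg fun x _ => ha τ x
    have hB0 : 0 ≤ B := sum_nonneg fun y _ => hb τ y
    have e1 : ∑ z : X × Y, c * (a τ z.1 * b τ z.2) * 1 = c * (A * B) := by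
      simp only [mul_one, ← mul_sum, Fintype.sum_prod_type, hA, hB, sum_mul_sum]
    have e2 : ∑ z : X × Y, c * (a τ z.1 * b τ z.2) * (sign (f z) * sign (out τ))
        = c * (A * B) * (sign (out τ) *
          ∑ x, ∑ y, a τ x / A * (b τ y / B) * sign (f (x, y))) := by
      rw [Fintype.sum_prod_type, ← mul_assoc, mul_sum]
      refine sum_congr rfl fun x _ => ?_
      rw [mul_sum]
      refine sum_congr rfl fun y _ => ?_
      -- If A = 0, every nonnegative summand is 0, so the identity survives division by zero.
      have hax : a τ x = A * (a τ x / A) := by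
        rcases hA0.eq_or_lt with h | h
        · rw [← h, zero_mul]
          exact (sum_eq_zero_iff_of_nonneg fun x _ => ha τ x).1 (h.symm) x (mem_univ x)
        · field_simp
      have hby : b τ y = B * (b τ y / B) := by
        rcases hB0.eq_or_lt with h | h
        · rw [← h, zero_mul]
          exact (sum_eq_zero_iff_of_nonneg fun x _ => hb τ x).1 (h.symm) y (mem_univ y)
        · field_simp
      conv_lhs => rw [hax, hby]
      ring
    simp only [e1, e2]
    rcases hA0.eq_or_lt with h | hApos
    · simp [← h]
    rcases hB0.eq_or_lt with h | hBpos
    · simp [← h]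
    have hmain := entropy_add_entropy_le (F := fun x y => sign (f (x, y)))
      (p := fun x => a τ x / A) (q := fun y => b τ y / B) (fun x y => (abs_sign _).le)
      (fun x => div_nonneg (ha τ x) hA0) (by rw [← sum_div, div_self hApos.ne'])
      (fun x => div_nonneg (hb τ x) hB0) (by rw [← sum_div, div_self hBpos.ne'])
      hN hX hY hK hε hbox
    have hs : sign (out τ) * ∑ x, ∑ y, a τ x / A * (b τ y / B) * sign (f (x, y))
        ≤ |∑ x, ∑ y, a τ x / A * (b τ y / B) * sign (f (x, y))| := by
      refine (le_abs_self _).trans ?_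
      rw [abs_mul, abs_sign, one_mul]
    have hs' := mul_le_mul_of_nonneg_left hs hK
    have hcAB : 0 ≤ c * (A * B) := by positivity
    have hfin := mul_le_mul_of_nonneg_left (hmain.trans (sub_le_sub_left hs' _)) hcAB
    rw [mul_comm B A]
    calc _ = _ := (mul_add _ _ _).symm
      _ ≤ _ := hfin
      _ = _ := by ring

/-! ### Box sums of inner product and of random functions -/

theorem card_bits (n : ℕ) : (Fintype.card (Bits n) : ℝ) = 2 ^ n := by simp

theorem sign_innerProduct {n : ℕ} (x y : Bits n) :
    sign (innerProduct n (x, y)) = ∏ i, sign (x i && y i) := by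
  have h1 : ∀ m : ℕ, sign (decide (m % 2 = 1)) = (-1) ^ m := by
    intro m
    rcases Nat.even_or_odd m with h | h
    · simp [sign, h.neg_one_pow, Nat.even_iff.1 h]
    · simp [sign, h.neg_one_pow, Nat.odd_iff.1 h]
  have h2 : ∀ u v : Bool, (-1 : ℝ) ^ (u.toNat * v.toNat) = sign (u && v) := by
    intro u v
    cases u <;> cases v <;> simp [sign]
  rw [innerProduct, h1, ← prod_pow_eq_pow_sum]
  exact prod_congr rfl fun i _ => h2 _ _

/-- Distinct characters are orthogonal, so only the 2^n diagonal pairs survive, each contributing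
(2^n)^2. -/
theorem boxSum_innerProduct (n : ℕ) :
    boxSum (fun x y : Bits n => sign (innerProduct n (x, y))) = (2 ^ n) ^ 3 := by
  have h : ∀ y y' : Bits n,
      ∑ x : Bits n, sign (innerProduct n (x, y)) * sign (innerProduct n (x, y'))
        = if y = y' then 2 ^ n else 0 := by
    intro y y'
    simp only [sign_innerProduct, ← prod_mul_distrib]
    rw [← Fintype.prod_sum fun i (b : Bool) => sign (b && y i) * sign (b && y' i)]
    split_ifs with h
    · subst h
      refine (prod_congr (g := fun _ => (2 : ℝ)) rfl fun i _ => ?_).trans (by simp)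
      cases y i <;> norm_num [sign]
    · obtain ⟨i, hi⟩ := Function.ne_iff.1 h
      refine prod_eq_zero (mem_univ i) ?_
      revert hi
      cases y i <;> cases y' i <;> norm_num [sign]
  simp only [boxSum, h, ite_pow, ne_eq, OfNat.ofNat_ne_zero, not_false_eq_true, zero_pow,
    sum_ite_eq, mem_univ, if_true, sum_const, card_univ, nsmul_eq_mul, card_bits]
  ring

/-- Flipping f at c₁ is a sign-reversing involution; the other three points may coincide. -/
theorem sum_sign_mul_eq_zero {γ : Type*} [Fintype γ] [DecidableEq γ] (c₁ c₂ c₃ c₄ : γ)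
    (h₂ : c₂ ≠ c₁) (h₃ : c₃ ≠ c₁) (h₄ : c₄ ≠ c₁) :
    ∑ f : γ → Bool, sign (f c₁) * sign (f c₂) * (sign (f c₃) * sign (f c₄)) = 0 := by
  refine sum_involution (fun f _ => Function.update f c₁ (!f c₁)) ?_ ?_ (fun _ _ => mem_univ _) ?_
  · intro f _
    rw [Function.update_self, Function.update_of_ne h₂, Function.update_of_ne h₃,
      Function.update_of_ne h₄]
    have : sign (!f c₁) = -sign (f c₁) := by cases f c₁ <;> norm_num [sign]
    rw [this]
    ring
  · intro f _ _ h
    have := congrFun h c₁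
    simp at this
  · intro f _
    simp

/-- Only degenerate rectangles, with x = x' or y = y', survive averaging over f; each has average at
most 1. -/
theorem sum_boxSum_le {α β : Type*} [Fintype α] [Fintype β] [DecidableEq α] [DecidableEq β] :
    ∑ f : α × β → Bool, boxSum (fun x y => sign (f (x, y)))
      ≤ Fintype.card (α × β → Bool) * ((Fintype.card β) ^ 2 * Fintype.card α
        + Fintype.card β * (Fintype.card α) ^ 2 : ℝ) := by
  have h1 : ∑ f : α × β → Bool, boxSum (fun x y => sign (f (x, y)))
      = ∑ y : β, ∑ y' : β, ∑ x : α, ∑ x' : α, ∑ f : α × β → Bool,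
        sign (f (x, y)) * sign (f (x, y')) * (sign (f (x', y)) * sign (f (x', y'))) := by
    simp only [boxSum, sq, sum_mul_sum]
    rw [sum_comm]
    refine sum_congr rfl fun y _ => ?_
    rw [sum_comm]
    refine sum_congr rfl fun y' _ => ?_
    rw [sum_comm]
    refine sum_congr rfl fun x _ => ?_
    rw [sum_comm]
  have h2 : ∀ (y y' : β) (x x' : α), ∑ f : α × β → Bool,
        sign (f (x, y)) * sign (f (x, y')) * (sign (f (x', y)) * sign (f (x', y')))
      ≤ (Fintype.card (α × β → Bool) : ℝ) *
        ((if x = x' then 1 else 0) + if y = y' then 1 else 0) := by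
    intro y y' x x'
    by_cases h : x ≠ x' ∧ y ≠ y'
    · rw [sum_sign_mul_eq_zero, if_neg h.1, if_neg h.2]
      · simp
      · simp [h.2.symm]
      · simp [h.1.symm]
      · simp [h.1.symm]
    · have hle : ∑ f : α × β → Bool,
          sign (f (x, y)) * sign (f (x, y')) * (sign (f (x', y)) * sign (f (x', y')))
          ≤ (Fintype.card (α × β → Bool) : ℝ) * 1 := by
        rw [← nsmul_eq_mul, ← card_univ]
        refine sum_le_card_nsmul _ _ _ fun f _ => (le_abs_self _).trans ?_
        simp [abs_mul, abs_sign]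
      refine hle.trans (mul_le_mul_of_nonneg_left ?_ (Nat.cast_nonneg _))
      rw [not_and_or, not_not, not_not] at h
      rcases h with h | h
      · rw [if_pos h]; split_ifs <;> norm_num
      · rw [if_pos h]; split_ifs <;> norm_num
  rw [h1]
  refine (sum_le_sum fun y _ => sum_le_sum fun y' _ => sum_le_sum fun x _ =>
    sum_le_sum fun x' _ => h2 y y' x x').trans (le_of_eq ?_)
  simp only [← mul_sum, sum_add_distrib, sum_ite_eq, mem_univ, if_true, sum_const, card_univ,
    nsmul_eq_mul, mul_one]
  congr 1
  ring

/-! ### Choice of parameters and the final bounds -/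

/-- The tree in which Alice sends her input and Bob answers with the value of `f`. -/
noncomputable def trivialTree {n : ℕ} (f : Bits n × Bits n → Bool) : ProtocolTree (Bits n) (Bits n) .alice :=
  .node (Fintype.card (Bits n))
    (fun i => List.ofFn ((Fintype.equivFin (Bits n)).symm i))
    (fun i j hij h => hij (by
      have := h.eq_of_length (by simp)
      exact (Fintype.equivFin (Bits n)).symm.injective (List.ofFn_injective this)))
    (fun x => PMF.pure (Fintype.equivFin (Bits n) x))
    (fun i => .node 2 (fun j => [decide (j = 1)])
      (fun j k hjk h => hjk (by revert h; fin_cases j <;> fin_cases k <;> simp))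
      (fun y => PMF.pure (if f ((Fintype.equivFin (Bits n)).symm i, y) then 1 else 0))
      (fun j => .leaf (decide (j = 1))))

theorem trivialTree_run {n : ℕ} (f : Bits n × Bits n → Bool) (x y : Bits n)
    (t : List Bool × Bool) (ht : (trivialTree f).run x y t ≠ 0) : t.2 = f (x, y) := by
  simp only [trivialTree, ProtocolTree.run, Player.see, PMF.pure_bind, PMF.pure_map,
    Equiv.symm_apply_apply] at ht
  rw [PMF.pure_apply] at ht
  simp only [ne_eq, ite_eq_right_iff, one_ne_zero, imp_false, not_not] at ht
  rw [ht]
  change decide ((if f (x, y) then (1 : Fin 2) else 0) = 1) = f (x, y)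
  cases f (x, y) <;> simp

/-- This makes the set in `informationComplexity` nonempty; the real infimum of the empty set would
be the default 0. -/
theorem exists_protocol {n : ℕ} (f : Bits n × Bits n → Bool) (μ : PMF (Bits n × Bits n)) :
    ∃ π : Protocol (Bits n) (Bits n), π.error μ f = 0 := by
  refine ⟨PMF.pure ⟨.alice, trivialTree f⟩, ?_⟩
  rw [Protocol.error, (PMF.toOuterMeasure_apply_eq_zero_iff _ _).2, ENNReal.toReal_zero]
  rw [Set.disjoint_left]
  rintro ⟨⟨x, y⟩, ⟨r, t⟩, o⟩ hsupp hne
  rw [PMF.mem_support_iff, Protocol.joint_apply, Protocol.run_apply, PMF.pure_apply] at hsupp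
  have h1 := left_ne_zero_of_mul (right_ne_zero_of_mul hsupp)
  have h2 := right_ne_zero_of_mul (right_ne_zero_of_mul hsupp)
  have h3 : r = ⟨.alice, trivialTree f⟩ := by by_contra h; exact h1 (if_neg h)
  subst h3
  exact hne (trivialTree_run f x y (t, o) h2)

theorem le_informationComplexity {n : ℕ} (hn : 256 ≤ n) (f : Bits n × Bits n → Bool)
    (hf : boxSum (fun x y => sign (f (x, y))) ≤ ((2 : ℝ) ^ n) ^ (7 / 2 : ℝ)) :
    1 / 64 * (n : ℝ) ≤ informationComplexity f (uniformInputs n) (1 / 10) := by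
  have hn' : (256 : ℝ) ≤ n := by exact_mod_cast hn
  have hpow : ((2 : ℝ) ^ n) = (2 : ℝ) ^ (n : ℝ) := (Real.rpow_natCast 2 n).symm
  -- K = n/16 and ε = 2^(-n/16) balance exactly: n/4 - 4n + 7n/2 = -n/4.
  have hbox : ((2 : ℝ) ^ ((n : ℝ) / 16) / 2 ^ n) ^ 4 * boxSum (fun x y => sign (f (x, y)))
      ≤ ((2 : ℝ) ^ (-((n : ℝ) / 16))) ^ 4 := by
    refine (mul_le_mul_of_nonneg_left hf (by positivity)).trans (le_of_eq ?_)
    rw [hpow, ← Real.rpow_mul (by norm_num), ← Real.rpow_sub (by norm_num),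
      ← Real.rpow_natCast, ← Real.rpow_natCast, ← Real.rpow_mul (by norm_num),
      ← Real.rpow_mul (by norm_num), ← Real.rpow_add (by norm_num)]
    congr 1
    push_cast
    ring
  have hε : (2 : ℝ) ^ (-((n : ℝ) / 16)) ≤ 1 / 4 := by
    calc (2 : ℝ) ^ (-((n : ℝ) / 16)) ≤ 2 ^ (-2 : ℝ) :=
          Real.rpow_le_rpow_of_exponent_le (by norm_num) (by linarith)
      _ = 1 / 4 := by rw [Real.rpow_neg (by norm_num)]; norm_num
  obtain ⟨π₀, hπ₀⟩ := exists_protocol f (uniformInputs n)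
  refine le_csInf ⟨_, π₀, by rw [hπ₀]; norm_num, rfl⟩ ?_
  rintro _ ⟨π, hπ, rfl⟩
  refine le_trans ?_ (π.le_infoCost f (card_bits n) (card_bits n) (by positivity)
    (by positivity) hbox)
  rw [uniformInputs] at hπ
  -- Here 11/20 = 1 - 2/10 - 1/4; n ≥ 256 then absorbs the loss of 4.
  have h : (n : ℝ) / 16 * (11 / 20) ≤ (n : ℝ) / 16 *
      (1 - 2 * π.error (PMF.uniformOfFintype (Bits n × Bits n)) f
        - (2 : ℝ) ^ (-((n : ℝ) / 16))) :=
    mul_le_mul_of_nonneg_left (by linarith) (by positivity)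
  linarith

theorem mul_card_filter_le_sum {γ : Type*} [Fintype γ] (g : γ → ℝ) (hg : ∀ x, 0 ≤ g x)
    (t : ℝ) : t * (#{x | t < g x} : ℝ) ≤ ∑ x, g x := by
  calc t * (#{x | t < g x} : ℝ) = ∑ x with t < g x, t := by
        rw [sum_const, nsmul_eq_mul, mul_comm]
    _ ≤ ∑ x with t < g x, g x := sum_le_sum fun x hx => (mem_filter.1 hx).2.le
    _ ≤ ∑ x, g x := sum_le_sum_of_subset_of_nonneg (filter_subset _ _) fun x _ _ => hg x

/-- Markov's inequality at threshold N^(7/2) against mean at most 2N^3 gives probability at most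
2N^(-1/2), which is below 2^(-n/4). -/
theorem randomFunction_le {n : ℕ} (hn : 256 ≤ n) :
    ((randomFunction n).toOuterMeasure
      {f | informationComplexity f (uniformInputs n) (1 / 10) < 1 / 64 * (n : ℝ)}).toReal
      ≤ (2 : ℝ) ^ (-(1 / 4 * (n : ℝ))) := by
  classical
  set N : ℝ := 2 ^ n with hNdef
  have hN : 0 < N := by positivity
  set S : Finset (Bits n × Bits n → Bool) :=
    {f | N ^ (7 / 2 : ℝ) < boxSum (fun x y => sign (f (x, y)))} with hS
  set C : ℝ := (Fintype.card (Bits n × Bits n → Bool) : ℝ) with hC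
  have hCpos : 0 < C := by rw [hC]; exact_mod_cast Fintype.card_pos
  have hsub : {f | informationComplexity f (uniformInputs n) (1 / 10) < 1 / 64 * (n : ℝ)}
      ⊆ (S : Set (Bits n × Bits n → Bool)) := by
    intro f hf
    simp only [hS, coe_filter, mem_univ, true_and, Set.mem_ofPred_eq]
    by_contra h
    exact absurd (le_informationComplexity hn f (not_lt.1 h)) (not_le.2 hf)
  have h1 : ((randomFunction n).toOuterMeasure (S : Set (Bits n × Bits n → Bool))).toReal
      = #S / C := by
    rw [randomFunction, PMF.toOuterMeasure_uniformOfFintype_apply, ENNReal.toReal_div]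
    simp [hC]
  have hfin : (randomFunction n).toOuterMeasure (S : Set (Bits n × Bits n → Bool)) ≠ ⊤ := by
    rw [PMF.toOuterMeasure_apply_finset]
    exact ENNReal.sum_ne_top.2 fun f _ => PMF.apply_ne_top _ _
  refine (ENNReal.toReal_mono hfin (MeasureTheory.measure_mono hsub)).trans ?_
  rw [h1, div_le_iff₀ hCpos]
  have h2 := (mul_card_filter_le_sum (fun f : Bits n × Bits n → Bool =>
    boxSum (fun x y => sign (f (x, y)))) (fun f => boxSum_nonneg _) (N ^ (7 / 2 : ℝ))).trans
      sum_boxSum_le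
  simp only [card_bits, ← hNdef, ← hC, ← hS] at h2
  have hn' : (256 : ℝ) ≤ n := by exact_mod_cast hn
  have h3 : 2 * N ^ 3 ≤ N ^ (7 / 2 : ℝ) * (2 : ℝ) ^ (-(1 / 4 * (n : ℝ))) := by
    have hpow : N = (2 : ℝ) ^ (n : ℝ) := (Real.rpow_natCast 2 n).symm
    rw [← Real.rpow_natCast, hpow, ← Real.rpow_mul (by norm_num), ← Real.rpow_mul (by norm_num),
      ← Real.rpow_add (by norm_num)]
    calc (2 : ℝ) * 2 ^ ((n : ℝ) * ((3 : ℕ) : ℝ)) = 2 ^ (1 + (n : ℝ) * ((3 : ℕ) : ℝ)) := by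
          rw [Real.rpow_add (by norm_num), Real.rpow_one]
      _ ≤ _ := Real.rpow_le_rpow_of_exponent_le (by norm_num) (by push_cast; linarith)
  have h4 : 0 < N ^ (7 / 2 : ℝ) := by positivity
  refine le_of_mul_le_mul_left (h2.trans ?_) h4
  calc C * (N ^ 2 * N + N * N ^ 2) = 2 * N ^ 3 * C := by ring
    _ ≤ _ * C := mul_le_mul_of_nonneg_right h3 hCpos.le
    _ = _ := by ring

end InfoComplexity

theorem mainTheorem5 :
    (∃ c : ℝ, 0 < c ∧ ∃ N : ℕ, ∀ n : ℕ, N ≤ n →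
      c * (n : ℝ) ≤
        InfoComplexity.informationComplexity (InfoComplexity.innerProduct n)
          (InfoComplexity.uniformInputs n) (1 / 10)) ∧
    (∃ c : ℝ, 0 < c ∧ ∃ d : ℝ, 0 < d ∧ ∃ N : ℕ, ∀ n : ℕ, N ≤ n →
      ((InfoComplexity.randomFunction n).toOuterMeasure
        {f | InfoComplexity.informationComplexity f (InfoComplexity.uniformInputs n) (1 / 10) <
          c * (n : ℝ)}).toReal ≤ (2 : ℝ) ^ (-(d * (n : ℝ)))) := by
  refine ⟨⟨1 / 64, by norm_num, 256, fun n hn =>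
    InfoComplexity.le_informationComplexity hn _ ?_⟩,
    1 / 64, by norm_num, 1 / 4, by norm_num, 256, fun n hn => InfoComplexity.randomFunction_le hn⟩
  rw [InfoComplexity.boxSum_innerProduct, ← Real.rpow_natCast]
  exact Real.rpow_le_rpow_of_exponent_le (one_le_pow₀ (by norm_num)) (by norm_num)
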